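/- Write an exponential sum on $\mathbb R^n$ as $f(x)=\sum_{\alpha}c_\alpha e^{\langle x,\alpha\rangle}$ (finitely many nonzero real coefficients $c_\alpha$, $\alpha\in\mathbb R^n$). A finite set $A\subset\mathbb R^n$ is a *simplicial circuit* if it is affinely dependent, all its proper subsets are affinely independent, and $\operatorname{conv}(A)$ is a simplex; singletons are also counted as circuits. An exponential sum $f$ supported on $A$ is a *circuit function* (on $A$) if $A$ is such a circuit, $c_\alpha>0$ for every vertex $\alpha$ of $\operatorname{conv}(A)$, and every non-vertex of $A$ lies in the relative interior of $\operatorname{conv}(A)$. *DSONC cone.* For disjoint finite sets $A^+,A^-\subset\mathbb R^n$ let $S_{A^+,A^-}$ be the set of all finite sums $g=\sum_\alpha g_\alpha e^{\langle x,\alpha\rangle}$ of nonnegative circuit functions with support in $A^+\cup A^-$ that satisfy $g_\alpha\ge 0$ for $\alpha\in A^+$ and $g_\beta\le 0$ for $\beta\in A^-$. Let $\check S_{A^+,A^-}$ be the set of all $v\in\mathbb R^{A^+\cup A^-}$ with $$\sum_{\alpha\in A^+}v_\alpha g_\alpha+\sum_{\beta\in A^-}|v_\beta|\,g_\beta\ \ge\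 0\qquad\text{for all } g\in S_{A^+,A^-}.$$ For finite $A\subset\mathbb R^n$, the DSONC cone of $A$ is the conic hull of all exponential sums $f$ for which there is a partition $A=A^+\sqcup A^-$ with $\#A^-\le 1$ and all vertices of $\operatorname{conv}(A)$ in $A^+$, such that $f$ is supported on $A$, $c_\alpha\ge 0$ on $A^+$, $c_\beta\le 0$ on $A^-$, and the coefficient vector of $f$ lies in $\check S_{A^+,A^-}$. **Statement.** Let $A=A^+\cup\{\beta\}\subset\mathbb R^n$ with $\#A^+=n+1$ and $\beta\notin A^+$, and let $$f(x)=\sum_{\alpha\in A^+}c_\alpha e^{\langle x,\alpha\rangle}+c_\beta e^{\langle x,\beta\rangle}$$ be a circuit function on $A$ with $c_\alpha>0$ for all $\alpha\in A^+$ and $c_\beta\le 0$. Then $f$ belongs to the DSONC cone of $A$ if and only if the tropical hypersurface $\mathcal T$ of $$\bigoplus_{\alpha\in A^+}\log|c_\alpha|\odot x^{\alpha}\ \oplus\ \log|c_\beta|\odot x^{\beta},$$ that is, the set of points $x\in\mathbb R^n$ at which the maximum of the values $\log|c_\alpha|+\langle x,\alpha\rangle$, $\alpha\in A$, is attained at least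 twice (with $\log 0=-\infty$), has genus zero, i.e. $\mathbb R^n\setminus\mathcal T$ has no bounded connected component. -/

import Mathlib

noncomputable section

namespace DSONC

/-- The space `ℝⁿ`, which contains both the exponents and the arguments of exponential sums. -/
abbrev Pt (n : ℕ) : Type := EuclideanSpace ℝ (Fin n)

/-- An exponential sum `∑ c_α exp ⟨x, α⟩` on `ℝⁿ`, given by its finitely supported family of
coefficients `α ↦ c_α` (these are uniquely determined by the function). -/
abbrev ExpSum (n : ℕ) : Type := Pt n →₀ ℝ

/-- The value of an exponential sum at a point. -/
def ExpSum.eval {n : ℕ} (f : ExpSum n) (x : Pt n) : ℝ :=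
  f.sum fun α c => c * Real.exp (inner ℝ x α)

/-- The vertices of the convex hull of `S`. -/
def vertices {n : ℕ} (S : Set (Pt n)) : Set (Pt n) :=
  (convexHull ℝ S).extremePoints ℝ

/-- A simplicial circuit: a minimally affinely dependent finite set whose convex hull is a simplex
(i.e. the vertices of the convex hull are affinely independent). -/
structure IsSimplicialCircuit {n : ℕ} (C : Finset (Pt n)) : Prop where
  dependent : ¬ AffineIndependent ℝ ((↑) : C → Pt n)
  minimal : ∀ D : Finset (Pt n), D ⊂ C → AffineIndependent ℝ ((↑) : D → Pt n)
  simplex : AffineIndependent ℝ ((↑) : vertices (C : Set (Pt n)) → Pt n)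

/-- Circuit functions supported on `A`. Singletons also count as circuits. -/
structure IsCircuitFunction {n : ℕ} (A : Finset (Pt n)) (f : ExpSum n) : Prop where
  support_subset : f.support ⊆ A
  circuit : IsSimplicialCircuit A ∨ ∃ α, A = {α}
  vertex_pos : ∀ α ∈ vertices (A : Set (Pt n)), 0 < f α
  inner_mem : ∀ β ∈ A, β ∉ vertices (A : Set (Pt n)) →
    β ∈ intrinsicInterior ℝ (convexHull ℝ (A : Set (Pt n)))

/-- The SONC cone of `A`: all sums of nonnegative circuit functions with support in `A`. -/
def soncCone {n : ℕ} (A : Set (Pt n)) : PointedCone ℝ (ExpSum n) :=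
  PointedCone.hull ℝ {f | ∃ C : Finset (Pt n), (C : Set (Pt n)) ⊆ A ∧ IsCircuitFunction C f ∧
    ∀ x, 0 ≤ f.eval x}

/-- The signed SONC cone: the part of the SONC cone of `A⁺ ∪ A⁻` in the orthant given by the
sign distribution `(A⁺, A⁻)`. -/
def signedSoncCone {n : ℕ} (Ap Am : Finset (Pt n)) : Set (ExpSum n) :=
  {f | f ∈ soncCone ((Ap : Set (Pt n)) ∪ Am) ∧ (∀ α ∈ Ap, 0 ≤ f α) ∧ ∀ β ∈ Am, f β ≤ 0}

/-- The dual of the signed SONC cone, as a set of vectors indexed by `A⁺ ∪ A⁻`. Membership depends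
only on the absolute value of a coordinate in `A⁻`: as the elements `f` of the signed SONC cone have
`f β ≤ 0` there, the condition says that the duality pairing of `v` with `f`, and with every
exponential sum obtained from `f` by changing signs of coefficients in `A⁻`, is nonnegative. For
`A⁻ = {β}` the set consists of the `v` with `v α ≥ 0` on `A⁺` and
`log |v β| ≤ ∑ λ α * log (v α)` for all ways of writing `β` as a convex combination
`∑ λ α • α` of `A⁺`. -/
def dualSoncCone {n : ℕ} (Ap Am : Finset (Pt n)) : Set (ExpSum n) :=
  {v | (v.support : Set (Pt n)) ⊆ (Ap : Set (Pt n)) ∪ Am ∧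
    ∀ f ∈ signedSoncCone Ap Am, 0 ≤ ∑ α ∈ Ap, v α * f α + ∑ β ∈ Am, |v β| * f β}

/-- `(A⁺, A⁻)` is a sign distribution on `A` for which all vertices of the convex hull of `A`
are positive. -/
structure IsSignDistribution {n : ℕ} (A Ap Am : Finset (Pt n)) : Prop where
  disjoint : Disjoint Ap Am
  union : (Ap : Set (Pt n)) ∪ Am = A
  vertices_subset : vertices (A : Set (Pt n)) ⊆ Ap

/-- AGE functions for the sign distribution `(A⁺, A⁻)`: there is at most one negative term. -/
structure IsAGE {n : ℕ} (Ap Am : Finset (Pt n)) (f : ExpSum n) : Prop where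
  card_le : Am.card ≤ 1
  support_subset : (f.support : Set (Pt n)) ⊆ (Ap : Set (Pt n)) ∪ Am
  nonneg : ∀ α ∈ Ap, 0 ≤ f α
  nonpos : ∀ β ∈ Am, f β ≤ 0

/-- The DSONC cone of `A`: the conic hull of all AGE functions on `A` whose coefficient vector lies
in the dual SONC cone (of the respective sign distribution). -/
def dsoncCone {n : ℕ} (A : Finset (Pt n)) : PointedCone ℝ (ExpSum n) :=
  PointedCone.hull ℝ {f | ∃ Ap Am : Finset (Pt n), IsSignDistribution A Ap Am ∧ IsAGE Ap Am f ∧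
    f ∈ dualSoncCone Ap Am}

/-- `log |c|` as an element of the max-plus semiring `ℝ ∪ {-∞}`, with `log 0 = -∞`. -/
def tropLog (c : ℝ) : WithBot ℝ :=
  if c = 0 then ⊥ else ((Real.log |c| : ℝ) : WithBot ℝ)

/-- The value at `x` of the tropical monomial `a ⊙ x^α`, i.e. `a + ⟨x, α⟩`. -/
def tropMonomial {n : ℕ} (a : WithBot ℝ) (α x : Pt n) : WithBot ℝ :=
  a + ((inner ℝ x α : ℝ) : WithBot ℝ)

/-- The value at `x` of the tropical (max-plus) polynomial `⨁_{α ∈ A} a α ⊙ x^α`. -/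
def tropEval {n : ℕ} (A : Finset (Pt n)) (a : Pt n → WithBot ℝ) (x : Pt n) : WithBot ℝ :=
  A.sup fun α => tropMonomial (a α) α x

/-- The tropical hypersurface of `⨁_{α ∈ A} a α ⊙ x^α`: the points at which the maximum is attained
by at least two of the tropical monomials. -/
def tropHypersurface {n : ℕ} (A : Finset (Pt n)) (a : Pt n → WithBot ℝ) : Set (Pt n) :=
  {x | ∃ α ∈ A, ∃ α' ∈ A, α ≠ α' ∧ tropMonomial (a α) α x = tropEval A a x ∧
    tropMonomial (a α') α' x = tropEval A a x}

/-- Genus zero: no connected component of the complement is bounded. -/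
def HasGenusZero {n : ℕ} (T : Set (Pt n)) : Prop :=
  ∀ x ∈ Tᶜ, ¬ Bornology.IsBounded (connectedComponentIn Tᶜ x)

end DSONC

end

noncomputable section

namespace DSONC

open scoped Classical

variable {n : ℕ}

/-! Write `β = ∑ w α • α` with positive weights on the vertices. Both properties are equivalent to
`-f β ≤ ∏ (f α) ^ w α`, stated with exponentials and logarithms in `mem_dsoncCone_iff` and
`hasGenusZero_iff`.

For the DSONC cone, pairing with the extremal AM-GM circuit function is a linear functional that is
nonnegative on all generators, and its value at `f` gives the inequality. Conversely, affine
independence provides a point `x` with `⟨x, α⟩ = log (f α) + k` at all vertices (`exists_inner_eq`).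
Evaluating a SONC function at `x` then bounds its pairing with `f`.

On the tropical side, the complement is a disjoint union of open convex regions, one per dominating
monomial. A nonempty region of a vertex contains a ray. The region of `β` is bounded, and averaging
the vertex monomials with weights `w` shows that it is nonempty exactly when the inequality fails.
-/

/-- `β` is a convex combination, with positive weights `w`, of the vertices `V` of an
`n`-dimensional simplex. -/
structure IsInteriorWeight (V : Finset (Pt n)) (β : Pt n) (w : Pt n → ℝ) : Prop where
  indep : AffineIndependent ℝ ((↑) : V → Pt n)
  card_eq : V.card = n + 1
  notMem : β ∉ V
  pos : ∀ α ∈ V, 0 < w α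
  sum_eq_one : ∑ α ∈ V, w α = 1
  sum_smul : ∑ α ∈ V, w α • α = β

/-! ### Simplices with an interior point -/

namespace IsInteriorWeight

variable {V : Finset (Pt n)} {β : Pt n} {w : Pt n → ℝ}

theorem inner_eq (h : IsInteriorWeight V β w) (x : Pt n) :
    inner ℝ x β = ∑ α ∈ V, w α * inner ℝ x α := by
  rw [← h.sum_smul, inner_sum]
  simp only [inner_smul_right]

theorem affineSpan_eq_top (h : IsInteriorWeight V β w) :
    affineSpan ℝ (V : Set (Pt n)) = ⊤ := by
  have := (h.indep.affineSpan_eq_top_iff_card_eq_finrank_add_one).2 (by simp [h.card_eq])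
  simpa using this

/-- Functions on the vertices of a full-dimensional simplex extend to affine functions. -/
theorem exists_inner_eq (h : IsInteriorWeight V β w) (b : Pt n → ℝ) :
    ∃ (x : Pt n) (k : ℝ), ∀ α ∈ V, inner ℝ x α = b α + k := by
  let B : AffineBasis V ℝ (Pt n) :=
    ⟨(↑), h.indep, by simpa using h.affineSpan_eq_top⟩
  let φ : Pt n →ᵃ[ℝ] ℝ := ∑ i : V, b i • B.coord i
  have hφ : ∀ α ∈ V, φ α = b α := by
    intro α hα
    have hB : B ⟨α, hα⟩ = α := rfl
    have : φ (B ⟨α, hα⟩) = b α := by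
      have hsum : ∀ (s : Finset V) (p : Pt n),
          (∑ i ∈ s, b i • B.coord i) p = ∑ i ∈ s, b i * B.coord i p := fun s p => by
        induction s using Finset.induction_on with
        | empty => simp
        | insert i s hi ih => simp [Finset.sum_insert hi, ← ih]
      rw [hsum, Finset.sum_eq_single ⟨α, hα⟩]
      · simp
      · intro i _ hi
        rw [B.coord_apply_ne hi, mul_zero]
      · simp
    rwa [hB] at this
  -- The Riesz vector of the linear part of `φ`; the constant term becomes `k`.
  refine ⟨(InnerProductSpace.toDual ℝ (Pt n)).symm (LinearMap.toContinuousLinearMap φ.linear),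
    -φ 0, fun α hα => ?_⟩
  rw [InnerProductSpace.toDual_symm_apply]
  have := congrFun (AffineMap.decomp' φ) α
  simp only [Pi.sub_apply] at this
  rw [LinearMap.coe_toContinuousLinearMap', this, hφ α hα, sub_eq_add_neg]

theorem exists_mem_ne (h : IsInteriorWeight V β w) (α : Pt n) : ∃ γ ∈ V, γ ≠ α := by
  by_contra! hc
  have hV : V ⊆ {α} := fun γ hγ => by simp [hc γ hγ]
  obtain ⟨γ, hγ⟩ : V.Nonempty := Finset.card_pos.1 (by rw [h.card_eq]; omega)
  have hV' : V = {γ} := by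
    ext δ
    simp only [Finset.mem_singleton]
    exact ⟨fun hδ => by rw [hc δ hδ, hc γ hγ], fun hδ => hδ ▸ hγ⟩
  have h1 := h.sum_eq_one
  have h2 := h.sum_smul
  rw [hV', Finset.sum_singleton] at h1 h2
  rw [h1, one_smul] at h2
  exact h.notMem (h2 ▸ hγ)

/-- Every vertex of a simplex is exposed, also against the points of the interior. -/
theorem exists_exposing (h : IsInteriorWeight V β w) {α : Pt n} (hα : α ∈ V) :
    ∃ d : Pt n, (∀ γ ∈ V, γ ≠ α → inner ℝ d γ < inner ℝ d α) ∧
      inner ℝ d β < inner ℝ d α := by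
  obtain ⟨d, k, hd⟩ := h.exists_inner_eq (fun γ => if γ = α then 1 else 0)
  have hV : ∀ γ ∈ V, γ ≠ α → inner ℝ d γ < inner ℝ d α := by
    intro γ hγ hne
    rw [hd γ hγ, hd α hα]
    simp [hne]
  refine ⟨d, hV, ?_⟩
  obtain ⟨γ, hγ, hne⟩ := h.exists_mem_ne α
  rw [h.inner_eq]
  calc ∑ δ ∈ V, w δ * inner ℝ d δ < ∑ δ ∈ V, w δ * inner ℝ d α := by
        refine Finset.sum_lt_sum (fun δ hδ => ?_)
          ⟨γ, hγ, mul_lt_mul_of_pos_left (hV γ hγ hne) (h.pos γ hγ)⟩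
        by_cases hδα : δ = α
        · rw [hδα]
        · exact (mul_lt_mul_of_pos_left (hV δ hδ hδα) (h.pos δ hδ)).le
    _ = inner ℝ d α := by rw [← Finset.sum_mul, h.sum_eq_one, one_mul]

theorem span_sub_eq_top (h : IsInteriorWeight V β w) :
    Submodule.span ℝ ((fun α => α - β) '' (insert β (V : Set (Pt n)))) = ⊤ := by
  have h1 := vectorSpan_eq_span_vsub_set_right ℝ (Set.mem_insert β (V : Set (Pt n)))
  simp only [vsub_eq_sub] at h1
  rw [← h1, ← direction_affineSpan, eq_top_iff, ← AffineSubspace.direction_top ℝ (Pt n) (Pt n),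
    ← h.affineSpan_eq_top]
  exact AffineSubspace.direction_le (affineSpan_mono ℝ (Set.subset_insert _ _))

/-- A set on which all the functionals `α - β`, for `α` a vertex, are bounded above is bounded. -/
theorem isBounded (h : IsInteriorWeight V β w) {S : Set (Pt n)} (M : Pt n → ℝ)
    (hS : ∀ y ∈ S, ∀ α ∈ V, inner ℝ y α ≤ inner ℝ y β + M α) : Bornology.IsBounded S := by
  have hgen : ∀ α ∈ V, ∃ C, ∀ y ∈ S, |inner ℝ y (α - β)| ≤ C := by
    intro α hα
    refine ⟨|M α| + |(∑ γ ∈ V.erase α, w γ * M γ) / w α|, fun y hy => abs_le.2 ⟨?_, ?_⟩⟩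
    -- The functionals `γ - β` have a vanishing positive combination, so upper bounds on the others
    -- bound this one from below.
    · have h0 : ∑ γ ∈ V, w γ * inner ℝ y (γ - β) = 0 := by
        simp only [inner_sub_right, mul_sub, Finset.sum_sub_distrib]
        rw [← h.inner_eq, ← Finset.sum_mul, h.sum_eq_one, one_mul, sub_self]
      rw [← Finset.add_sum_erase V _ hα] at h0
      have h1 : ∑ γ ∈ V.erase α, w γ * inner ℝ y (γ - β) ≤ ∑ γ ∈ V.erase α, w γ * M γ := by
        refine Finset.sum_le_sum fun γ hγ => ?_
        have hγ' := Finset.mem_of_mem_erase hγ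
        refine mul_le_mul_of_nonneg_left ?_ (h.pos γ hγ').le
        rw [inner_sub_right]
        linarith [hS y hy γ hγ']
      have h2 : -inner ℝ y (α - β) ≤ (∑ γ ∈ V.erase α, w γ * M γ) / w α := by
        rw [le_div_iff₀ (h.pos α hα)]
        linarith
      linarith [abs_nonneg (M α), le_abs_self ((∑ γ ∈ V.erase α, w γ * M γ) / w α)]
    · rw [inner_sub_right]
      linarith [hS y hy α hα, le_abs_self (M α),
        abs_nonneg ((∑ γ ∈ V.erase α, w γ * M γ) / w α)]
  have hall : ∀ v : Pt n, ∃ C, ∀ y ∈ S, |inner ℝ y v| ≤ C := by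
    intro v
    have hv : v ∈ Submodule.span ℝ ((fun α => α - β) '' (insert β (V : Set (Pt n)))) := by
      rw [h.span_sub_eq_top]
      trivial
    induction hv using Submodule.span_induction with
    | mem v hv =>
      obtain ⟨α, hα, rfl⟩ := hv
      rcases hα with rfl | hα
      · exact ⟨0, fun y _ => by simp⟩
      · exact hgen α hα
    | zero => exact ⟨0, fun y _ => by simp⟩
    | add u v _ _ hu hv =>
      obtain ⟨C, hC⟩ := hu
      obtain ⟨D, hD⟩ := hv
      refine ⟨C + D, fun y hy => ?_⟩
      rw [inner_add_right]
      exact (abs_add_le _ _).trans (add_le_add (hC y hy) (hD y hy))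
    | smul r v _ hv =>
      obtain ⟨C, hC⟩ := hv
      refine ⟨|r| * C, fun y hy => ?_⟩
      rw [inner_smul_right, abs_mul]
      exact mul_le_mul_of_nonneg_left (hC y hy) (abs_nonneg r)
  choose C hC using fun i : Fin n => hall (EuclideanSpace.single i 1)
  refine isBounded_iff_forall_norm_le.2 ⟨√(∑ i, C i ^ 2), fun y hy => ?_⟩
  rw [EuclideanSpace.norm_eq]
  refine Real.sqrt_le_sqrt (Finset.sum_le_sum fun i _ => ?_)
  have := hC i y hy
  simp only [EuclideanSpace.inner_single_right] at this
  rw [Real.norm_eq_abs]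
  refine pow_le_pow_left₀ (abs_nonneg _) ?_ 2
  simpa using this

end IsInteriorWeight

/-! ### Simplicial circuits -/

/-- Otherwise `β` would be affinely dependent on the other points of the proper subset `A.erase α`.
-/
theorem IsSimplicialCircuit.notMem_convexHull {A : Finset (Pt n)} (hA : IsSimplicialCircuit A)
    {α β : Pt n} (hα : α ∈ A) (hβ : β ∈ A) (hne : α ≠ β) :
    β ∉ convexHull ℝ (((A.erase β).erase α : Finset (Pt n)) : Set (Pt n)) := by
  intro hmem
  have hind := hA.minimal (A.erase α) (Finset.erase_ssubset hα)
  have hβ' : β ∈ A.erase α := Finset.mem_erase.2 ⟨hne.symm, hβ⟩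
  refine hind.notMem_affineSpan_sdiff ⟨β, hβ'⟩ Set.univ ?_
  refine affineSpan_mono ℝ ?_ (convexHull_subset_affineSpan _ hmem)
  intro γ hγ
  simp only [Finset.coe_erase, Set.mem_sdiff, Finset.mem_coe, Set.mem_singleton_iff] at hγ
  refine ⟨⟨γ, Finset.mem_erase.2 ⟨hγ.2, hγ.1.1⟩⟩, ⟨trivial, ?_⟩, rfl⟩
  simp only [Set.mem_singleton_iff, Subtype.mk.injEq]
  exact hγ.1.2

theorem vertices_subset (A : Finset (Pt n)) : vertices (A : Set (Pt n)) ⊆ A :=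
  extremePoints_convexHull_subset

/-- Krein–Milman; the hull of finitely many points is already closed. -/
theorem convexHull_vertices (A : Finset (Pt n)) :
    convexHull ℝ (vertices (A : Set (Pt n))) = convexHull ℝ (A : Set (Pt n)) := by
  have hfin : (vertices (A : Set (Pt n))).Finite := A.finite_toSet.subset (vertices_subset A)
  have := closure_convexHull_extremePoints (s := convexHull ℝ (A : Set (Pt n)))
    (A.finite_toSet.isCompact_convexHull ℝ) (convex_convexHull ℝ _)
  rw [← this]
  exact (hfin.isClosed_convexHull ℝ).closure_eq.symm

/-- A non-vertex of a simplicial circuit is the only one. -/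
theorem IsSimplicialCircuit.vertices_eq {A : Finset (Pt n)} (hA : IsSimplicialCircuit A)
    {β : Pt n} (hβ : β ∈ A) (hβv : β ∉ vertices (A : Set (Pt n))) :
    vertices (A : Set (Pt n)) = (A.erase β : Finset (Pt n)) := by
  refine Set.Subset.antisymm (fun α hα => ?_) (fun α hα => ?_)
  · exact Finset.mem_erase.2 ⟨fun h => hβv (h ▸ hα), vertices_subset A hα⟩
  · by_contra hαv
    have hα' := Finset.mem_erase.1 (Finset.mem_coe.1 hα)
    refine hA.notMem_convexHull hα'.2 hβ hα'.1 ?_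
    have hmem : β ∈ convexHull ℝ (vertices (A : Set (Pt n))) := by
      rw [convexHull_vertices]
      exact subset_convexHull ℝ _ hβ
    refine convexHull_mono (fun γ hγ => ?_) hmem
    refine Finset.mem_erase.2 ⟨fun h => hαv (h ▸ hγ), Finset.mem_erase.2
      ⟨fun h => hβv (h ▸ hγ), vertices_subset A hγ⟩⟩

theorem IsSimplicialCircuit.exists_isInteriorWeight {A : Finset (Pt n)}
    (hA : IsSimplicialCircuit A) (hcard : A.card = n + 2) {β : Pt n} (hβ : β ∈ A)
    (hβv : β ∉ vertices (A : Set (Pt n))) : ∃ w, IsInteriorWeight (A.erase β) β w := by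
  have hmem : β ∈ convexHull ℝ ((A.erase β : Finset (Pt n)) : Set (Pt n)) := by
    rw [← hA.vertices_eq hβ hβv, convexHull_vertices]
    exact subset_convexHull ℝ _ hβ
  obtain ⟨w, hw0, hw1, hwβ⟩ := Finset.mem_convexHull'.1 hmem
  refine ⟨w, hA.minimal _ (Finset.erase_ssubset hβ), ?_, Finset.notMem_erase _ _, ?_, hw1, hwβ⟩
  · rw [Finset.card_erase_of_mem hβ, hcard]
    rfl
  · intro α hα
    -- A zero weight at `α` would place `β` in the hull of the remaining points.
    refine lt_of_le_of_ne (hw0 α hα) fun h0 => ?_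
    have hα' := Finset.mem_erase.1 hα
    refine hA.notMem_convexHull hα'.2 hβ hα'.1 (Finset.mem_convexHull'.2 ⟨w, ?_, ?_, ?_⟩)
    · exact fun γ hγ => hw0 γ (Finset.mem_of_mem_erase hγ)
    · rw [← hw1, ← Finset.add_sum_erase _ _ hα, ← h0, zero_add]
    · rw [← Finset.add_sum_erase _ _ hα, ← h0, zero_smul, zero_add] at hwβ
      exact hwβ

/-! ### Exponential sums and the SONC cone -/

theorem ExpSum.eval_eq_sum {f : ExpSum n} {A : Finset (Pt n)} (hf : f.support ⊆ A) (x : Pt n) :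
    f.eval x = ∑ α ∈ A, f α * Real.exp (inner ℝ x α) :=
  Finsupp.sum_of_support_subset _ hf _ (by simp)

theorem ExpSum.eval_add (f g : ExpSum n) (x : Pt n) : (f + g).eval x = f.eval x + g.eval x :=
  Finsupp.sum_add_index' (by simp) (fun _ _ _ => add_mul _ _ _)

theorem support_subset_of_mem_soncCone {A : Finset (Pt n)} {g : ExpSum n}
    (hg : g ∈ soncCone (A : Set (Pt n))) : g.support ⊆ A := by
  suffices h : ∀ α ∉ A, g α = 0 by
    intro α hα
    by_contra hαA
    exact Finsupp.mem_support_iff.1 hα (h α hαA)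
  intro α hα
  induction hg using Submodule.span_induction with
  | mem g hg =>
    obtain ⟨C, hC, hgC, -⟩ := hg
    exact Finsupp.notMem_support_iff.1 fun h => hα (hC (hgC.support_subset h))
  | zero => rfl
  | add f g _ _ hf hg => simp [hf, hg]
  | smul r g _ hg =>
    change (r : ℝ) * g α = 0
    rw [hg, mul_zero]

theorem eval_nonneg_of_mem_soncCone {A : Finset (Pt n)} {g : ExpSum n}
    (hg : g ∈ soncCone (A : Set (Pt n))) (x : Pt n) : 0 ≤ g.eval x := by
  induction hg using Submodule.span_induction with
  | mem g hg =>
    obtain ⟨C, hC, hgC, h0⟩ := hg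
    exact h0 x
  | zero => simp [ExpSum.eval]
  | add f g _ _ hf hg =>
    rw [ExpSum.eval_add]
    exact add_nonneg hf hg
  | smul r g _ hg =>
    have : (r • g).eval x = r * g.eval x := by
      change ExpSum.eval ((r : ℝ) • g) x = _
      rw [ExpSum.eval, Finsupp.sum_smul_index (by simp), ExpSum.eval, Finsupp.mul_sum]
      simp only [mul_assoc]
    rw [this]
    exact mul_nonneg r.2 hg

/-- The nonnegative circuit function with vertex coefficients `w α * exp (-l α)`, whose inner
coefficient is as small as possible. -/
def extremalCircuit (V : Finset (Pt n)) (β : Pt n) (w l : Pt n → ℝ) : ExpSum n :=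
  Finsupp.indicator (insert β V) fun α _ =>
    if α = β then -Real.exp (-∑ γ ∈ V, w γ * l γ) else w α * Real.exp (-l α)

section extremalCircuit

variable {V : Finset (Pt n)} {β : Pt n} {w l : Pt n → ℝ}

theorem extremalCircuit_support_subset : (extremalCircuit V β w l).support ⊆ insert β V :=
  Finsupp.support_indicator_subset ..

theorem extremalCircuit_inner :
    extremalCircuit V β w l β = -Real.exp (-∑ γ ∈ V, w γ * l γ) := by
  rw [extremalCircuit, Finsupp.indicator_of_mem (Finset.mem_insert_self β V), if_pos rfl]

theorem extremalCircuit_vertex (hβ : β ∉ V) {α : Pt n} (hα : α ∈ V) :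
    extremalCircuit V β w l α = w α * Real.exp (-l α) := by
  rw [extremalCircuit, Finsupp.indicator_of_mem (Finset.mem_insert_of_mem hα),
    if_neg (ne_of_mem_of_not_mem hα hβ)]

/-- Jensen's inequality for `exp` at the points `-l α + ⟨x, α⟩`, i.e. weighted AM-GM. -/
theorem extremalCircuit_eval_nonneg (h : IsInteriorWeight V β w) (x : Pt n) :
    0 ≤ (extremalCircuit V β w l).eval x := by
  rw [ExpSum.eval_eq_sum extremalCircuit_support_subset, Finset.sum_insert h.notMem,
    extremalCircuit_inner]
  have hV : ∑ α ∈ V, extremalCircuit V β w l α * Real.exp (inner ℝ x α) =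
      ∑ α ∈ V, w α * Real.exp (-l α + inner ℝ x α) := by
    refine Finset.sum_congr rfl fun α hα => ?_
    rw [extremalCircuit_vertex h.notMem hα, Real.exp_add, mul_assoc]
  have hJ := convexOn_exp.map_sum_le (t := V) (w := w) (p := fun α => -l α + inner ℝ x α)
    (fun α hα => (h.pos α hα).le) h.sum_eq_one (fun _ _ => Set.mem_univ _)
  simp only [smul_eq_mul, mul_add, Finset.sum_add_distrib, mul_neg, Finset.sum_neg_distrib] at hJ
  rw [hV, neg_mul, ← Real.exp_add, h.inner_eq]
  linarith

end extremalCircuit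

/-! ### Membership in the DSONC cone -/

/-- The condition on the coefficients that describes both the DSONC cone and genus zero. -/
theorem mem_dsoncCone_iff {A : Finset (Pt n)} {β : Pt n} {w : Pt n → ℝ} {f : ExpSum n}
    (hf : IsCircuitFunction A f) (hA : IsSimplicialCircuit A) (hβ : β ∈ A)
    (hβv : β ∉ vertices (A : Set (Pt n))) (h : IsInteriorWeight (A.erase β) β w)
    (hpos : ∀ α ∈ A.erase β, 0 < f α) (hneg : f β ≤ 0) :
    f ∈ dsoncCone A ↔ -f β ≤ Real.exp (∑ α ∈ A.erase β, w α * Real.log (f α)) := by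
  set V := A.erase β with hV
  have hins : insert β V = A := Finset.insert_erase hβ
  have hverts := hA.vertices_eq hβ hβv
  rw [← hV] at hverts
  have hunion : (V : Set (Pt n)) ∪ ({β} : Finset (Pt n)) = A := by
    rw [← hins]
    ext α
    simp
  constructor
  · intro hmem
    -- This choice makes the vertex coefficients of `g` equal to `w α / f α`, so the vertex part of
    -- the pairing is `∑ w α = 1`.
    set l : Pt n → ℝ := fun α => Real.log (f α) with hl
    set g := extremalCircuit V β w l with hg
    have hgV : ∀ α ∈ V, g α = w α * Real.exp (-l α) := fun α hα =>
      extremalCircuit_vertex h.notMem hα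
    have hgV0 : ∀ α ∈ V, 0 < g α := fun α hα => by
      rw [hgV α hα]
      exact mul_pos (h.pos α hα) (Real.exp_pos _)
    have hgβ : g β = -Real.exp (-∑ γ ∈ V, w γ * l γ) := extremalCircuit_inner
    have hgβ0 : g β < 0 := by
      rw [hgβ]
      exact neg_neg_of_pos (Real.exp_pos _)
    have hgc : IsCircuitFunction A g :=
      { support_subset := hins ▸ extremalCircuit_support_subset
        circuit := Or.inl hA
        vertex_pos := fun α hα => hgV0 α (by rwa [hverts] at hα)
        inner_mem := hf.inner_mem }
    have hgs : g ∈ signedSoncCone V {β} := by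
      refine ⟨?_, fun α hα => (hgV0 α hα).le, fun γ hγ => ?_⟩
      · rw [hunion]
        exact Submodule.subset_span ⟨A, subset_rfl, hgc, extremalCircuit_eval_nonneg h⟩
      · rw [Finset.mem_singleton.1 hγ]
        exact hgβ0.le
    have hL : 0 ≤ ∑ α ∈ V, f α * g α - f β * g β := by
      clear_value g l
      clear hneg hpos hf hl
      induction hmem using Submodule.span_induction with
      | mem v hv =>
        obtain ⟨Ap, Am, hsd, hage, hdual⟩ := hv
        have hVAp : V ⊆ Ap := fun α hα => hsd.vertices_subset (by rw [hverts]; exact hα)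
        -- If `β` is counted as positive, signs alone suffice; otherwise the sign distribution must
        -- be `(V, {β})` and duality applies to `g`.
        by_cases hβp : β ∈ Ap
        · have h1 : 0 ≤ ∑ α ∈ V, v α * g α := Finset.sum_nonneg fun α hα =>
            mul_nonneg (hage.nonneg α (hVAp hα)) (hgV0 α hα).le
          have h2 := mul_nonpos_of_nonneg_of_nonpos (hage.nonneg β hβp) hgβ0.le
          linarith
        · have hApA : Ap ⊆ A := fun α hα => by
            have : α ∈ (Ap : Set (Pt n)) ∪ Am := Or.inl hα
            rwa [hsd.union] at this
          have hAp : Ap = V := by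
            refine Finset.Subset.antisymm (fun α hα => Finset.mem_erase.2 ⟨?_, hApA hα⟩) hVAp
            exact fun hαβ => hβp (hαβ ▸ hα)
          have hβm : β ∈ Am := by
            have : β ∈ (Ap : Set (Pt n)) ∪ Am := by
              rw [hsd.union]
              exact hβ
            exact this.resolve_left hβp
          have hAm : Am = {β} := by
            refine Finset.eq_singleton_iff_unique_mem.2 ⟨hβm, fun γ hγ => ?_⟩
            exact Finset.card_le_one.1 hage.card_le γ hγ β hβm
          subst hAp hAm
          have := hdual.2 g hgs
          rw [Finset.sum_singleton, abs_of_nonpos (hage.nonpos β hβm)] at this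
          linarith
      | zero => simp
      | add u v _ _ hu hv =>
        simp only [Finsupp.add_apply, add_mul, Finset.sum_add_distrib]
        linarith
      | smul r v _ hv =>
        have hr : ∀ γ, (r • v) γ = (r : ℝ) * v γ := fun γ => rfl
        simp only [hr, mul_assoc]
        rw [← Finset.mul_sum, ← mul_sub]
        exact mul_nonneg r.2 hv
    have h1 : ∑ α ∈ V, f α * g α = 1 := by
      rw [← h.sum_eq_one]
      refine Finset.sum_congr rfl fun α hα => ?_
      rw [hgV α hα, Real.exp_neg, Real.exp_log (hpos α hα)]
      field_simp [(hpos α hα).ne']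
    rw [h1, hgβ, Real.exp_neg] at hL
    have hE := Real.exp_pos (∑ γ ∈ V, w γ * l γ)
    have h2 : -f β / Real.exp (∑ γ ∈ V, w γ * l γ) ≤ 1 := by
      rw [div_eq_mul_inv]
      linarith
    rwa [div_le_one hE] at h2
  · intro hle
    refine Submodule.subset_span ⟨V, {β}, ⟨?_, hunion, hverts.le⟩, ⟨by simp, ?_,
      fun α hα => (hpos α hα).le, ?_⟩, ?_, ?_⟩
    · exact Finset.disjoint_singleton_right.2 h.notMem
    · rw [hunion]
      exact_mod_cast hf.support_subset
    · intro γ hγ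
      rwa [Finset.mem_singleton.1 hγ]
    · rw [hunion]
      exact_mod_cast hf.support_subset
    · rintro g ⟨hgs, hgp, hgm⟩
      rw [hunion] at hgs
      -- At this `x`, `g.eval x` is `exp k` times the pairing with `-f β` replaced by its upper
      -- bound; as `g β ≤ 0`, undoing the replacement only increases the value.
      obtain ⟨x, k, hx⟩ := h.exists_inner_eq (fun α => Real.log (f α))
      have hev := eval_nonneg_of_mem_soncCone hgs x
      rw [ExpSum.eval_eq_sum (support_subset_of_mem_soncCone hgs), ← hins,
        Finset.sum_insert h.notMem, h.inner_eq] at hev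
      have h1 : ∑ α ∈ V, g α * Real.exp (inner ℝ x α) =
          (∑ α ∈ V, f α * g α) * Real.exp k := by
        rw [Finset.sum_mul]
        refine Finset.sum_congr rfl fun α hα => ?_
        rw [hx α hα, Real.exp_add, Real.exp_log (hpos α hα)]
        ring
      have h2 : ∑ α ∈ V, w α * inner ℝ x α = ∑ α ∈ V, w α * Real.log (f α) + k := by
        rw [Finset.sum_congr rfl fun α hα => by rw [hx α hα]]
        simp only [mul_add, Finset.sum_add_distrib]
        rw [← Finset.sum_mul, h.sum_eq_one, one_mul]
      rw [h1, h2, Real.exp_add, ← mul_assoc, ← add_mul] at hev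
      have h3 := nonneg_of_mul_nonneg_left hev (Real.exp_pos k)
      have h4 := mul_le_mul_of_nonpos_left hle (hgm β (Finset.mem_singleton_self β))
      rw [Finset.sum_singleton, abs_of_nonpos hneg]
      linarith

/-! ### Regions of the tropical complement -/

/-- The region on which the monomial `α` of a tropical polynomial strictly dominates. -/
def tropRegion (A : Finset (Pt n)) (a : Pt n → WithBot ℝ) (α : Pt n) : Set (Pt n) :=
  {x | ∀ γ ∈ A, γ ≠ α → tropMonomial (a γ) γ x < tropMonomial (a α) α x}

theorem compl_tropHypersurface {A : Finset (Pt n)} (hA : A.Nonempty) (a : Pt n → WithBot ℝ) :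
    (tropHypersurface A a)ᶜ = ⋃ α ∈ A, tropRegion A a α := by
  ext x
  have hle : ∀ γ ∈ A, tropMonomial (a γ) γ x ≤ tropEval A a x := fun γ hγ =>
    Finset.le_sup (f := fun α => tropMonomial (a α) α x) hγ
  simp only [Set.mem_compl_iff, Set.mem_iUnion, exists_prop]
  constructor
  · intro hx
    obtain ⟨α, hα, hmax⟩ := Finset.exists_mem_eq_sup A hA fun α => tropMonomial (a α) α x
    refine ⟨α, hα, fun γ hγ hne => ?_⟩
    rw [← hmax]
    exact lt_of_le_of_ne (hle γ hγ) fun heq => hx ⟨γ, hγ, α, hα, hne, heq, hmax.symm⟩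
  · rintro ⟨α, hα, hx⟩ ⟨γ, hγ, δ, hδ, hne, hγe, hδe⟩
    have key : ∀ ε ∈ A, tropMonomial (a ε) ε x = tropEval A a x → ε = α := by
      intro ε hε he
      by_contra hεα
      exact (hx ε hε hεα).not_ge (he ▸ hle α hα)
    exact hne ((key γ hγ hγe).trans (key δ hδ hδe).symm)

theorem disjoint_tropRegion {A : Finset (Pt n)} {a : Pt n → WithBot ℝ} {α γ : Pt n}
    (hα : α ∈ A) (hγ : γ ∈ A) (hne : α ≠ γ) :
    Disjoint (tropRegion A a α) (tropRegion A a γ) :=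
  Set.disjoint_left.2 fun _ hx hy => (hx γ hγ hne.symm).asymm (hy α hα hne)

theorem tropMonomial_tropLog {c : ℝ} (hc : c ≠ 0) (α x : Pt n) :
    tropMonomial (tropLog c) α x = ((Real.log |c| + inner ℝ x α : ℝ) : WithBot ℝ) := by
  rw [tropMonomial, tropLog, if_neg hc, WithBot.coe_add]

theorem tropMonomial_tropLog_zero (α x : Pt n) : tropMonomial (tropLog 0) α x = ⊥ := by
  rw [tropMonomial, tropLog, if_pos rfl, WithBot.bot_add]

/-- A finite intersection of open half-spaces, hence open and convex; zero coefficients give the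
value `⊥` and impose no constraint. -/
theorem tropRegion_eq {A : Finset (Pt n)} {c : Pt n → ℝ} {α : Pt n} (hα : c α ≠ 0) :
    tropRegion A (fun α => tropLog (c α)) α =
      ⋂ γ ∈ A.filter (fun γ => γ ≠ α ∧ c γ ≠ 0),
        {x | inner ℝ (γ - α) x < Real.log |c α| - Real.log |c γ|} := by
  ext x
  simp only [tropRegion, Set.mem_ofPred_eq, Set.mem_iInter, Finset.mem_filter]
  refine forall_congr' fun γ => ?_
  by_cases hγ : c γ = 0
  · rw [hγ, tropMonomial_tropLog_zero, tropMonomial_tropLog hα]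
    simp [WithBot.bot_lt_coe]
  · rw [tropMonomial_tropLog hα, tropMonomial_tropLog hγ, WithBot.coe_lt_coe, inner_sub_left,
      real_inner_comm, real_inner_comm x α]
    have : ∀ a b c d : ℝ, a + b < c + d ↔ b - d < c - a := fun a b c d => by
      constructor <;> intro <;> linarith
    rw [this]
    tauto

theorem convex_tropRegion {A : Finset (Pt n)} {c : Pt n → ℝ} {α : Pt n} (hα : c α ≠ 0) :
    Convex ℝ (tropRegion A (fun α => tropLog (c α)) α) := by
  rw [tropRegion_eq hα]
  exact convex_iInter₂ fun γ _ => convex_halfSpace_lt (innerₗ (Pt n) (γ - α)).isLinear _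

theorem isOpen_tropRegion {A : Finset (Pt n)} {c : Pt n → ℝ} {α : Pt n} (hα : c α ≠ 0) :
    IsOpen (tropRegion A (fun α => tropLog (c α)) α) := by
  rw [tropRegion_eq hα]
  exact isOpen_biInter_finset fun γ _ => isOpen_lt (by fun_prop) continuous_const

/-- The exposing direction `d` is a recession direction, so the region contains the ray from `x`
along `d`. -/
theorem not_isBounded_tropRegion {A : Finset (Pt n)} {c : Pt n → ℝ} {α γ d x : Pt n}
    (hα : c α ≠ 0) (hγ : γ ∈ A) (hne : γ ≠ α)
    (hd : ∀ γ ∈ A, γ ≠ α → inner ℝ d γ < inner ℝ d α)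
    (hx : x ∈ tropRegion A (fun α => tropLog (c α)) α) :
    ¬ Bornology.IsBounded (tropRegion A (fun α => tropLog (c α)) α) := by
  intro hb
  obtain ⟨C, hC⟩ := isBounded_iff_forall_norm_le.1 hb
  have hd0 : d ≠ 0 := by
    rintro rfl
    simpa using hd γ hγ hne
  have hd0' : 0 < ‖d‖ := norm_pos_iff.2 hd0
  have hray : ∀ t : ℝ, 0 ≤ t → x + t • d ∈ tropRegion A (fun α => tropLog (c α)) α := by
    intro t ht
    rw [tropRegion_eq hα] at hx ⊢
    simp only [Set.mem_iInter, Set.mem_ofPred_eq] at hx ⊢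
    intro δ hδ
    have h1 := hx δ hδ
    have hδ' := Finset.mem_filter.1 hδ
    have h2 := hd δ hδ'.1 hδ'.2.1
    have h3 : inner ℝ (δ - α) d ≤ 0 := by
      rw [inner_sub_left, real_inner_comm, real_inner_comm d α]
      linarith
    rw [inner_add_right, inner_smul_right]
    linarith [mul_nonpos_of_nonneg_of_nonpos ht h3]
  have hCx := hC x hx
  have hC0 : 0 ≤ C := (norm_nonneg x).trans hCx
  -- This moves `x` by `2 * C + 1`, more than the distance `2 * C` possible between points of norm
  -- at most `C`.
  have ht : 0 ≤ (2 * C + 1) / ‖d‖ := by positivity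
  have h1 := hC _ (hray _ ht)
  have h2 : ‖((2 * C + 1) / ‖d‖) • d‖ = 2 * C + 1 := by
    rw [norm_smul, Real.norm_of_nonneg ht, div_mul_cancel₀ _ hd0'.ne']
  have h3 := norm_sub_le (x + ((2 * C + 1) / ‖d‖) • d) x
  rw [add_sub_cancel_left, h2] at h3
  linarith

theorem hasGenusZero_iff {A : Finset (Pt n)} {β : Pt n} {w : Pt n → ℝ} {f : ExpSum n}
    (hβ : β ∈ A) (h : IsInteriorWeight (A.erase β) β w)
    (hpos : ∀ α ∈ A.erase β, 0 < f α) (hneg : f β ≤ 0) :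
    HasGenusZero (tropHypersurface A fun α => tropLog (f α)) ↔
      -f β ≤ Real.exp (∑ α ∈ A.erase β, w α * Real.log (f α)) := by
  set V := A.erase β with hV
  have hVA : ∀ α ∈ V, α ∈ A := fun α hα => Finset.mem_of_mem_erase hα
  rw [HasGenusZero, compl_tropHypersurface ⟨β, hβ⟩]
  set R := tropRegion A fun α => tropLog (f α) with hR
  constructor
  · intro hgen
    by_contra! hlt
    have hβneg : 0 < -f β := (Real.exp_pos _).trans hlt
    have hβ0 : f β ≠ 0 := by linarith
    have hlog : ∑ α ∈ V, w α * Real.log (f α) < Real.log |f β| := by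
      rw [abs_of_nonpos hneg]
      exact (Real.lt_log_iff_exp_lt hβneg).2 hlt
    -- All vertex monomials take the same value `k` at this `x`, and the monomial of `β` exceeds it.
    obtain ⟨x, k, hx⟩ := h.exists_inner_eq (fun α => -Real.log (f α))
    have hxβ : inner ℝ x β = -∑ α ∈ V, w α * Real.log (f α) + k := by
      rw [h.inner_eq, Finset.sum_congr rfl fun α hα => by rw [hx α hα]]
      simp only [mul_add, Finset.sum_add_distrib, mul_neg, Finset.sum_neg_distrib]
      rw [← Finset.sum_mul, h.sum_eq_one, one_mul]
    have hxR : x ∈ R β := by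
      intro γ hγ hne
      have hγV : γ ∈ V := Finset.mem_erase.2 ⟨hne, hγ⟩
      rw [tropMonomial_tropLog (hpos γ hγV).ne', tropMonomial_tropLog hβ0, WithBot.coe_lt_coe,
        hxβ, hx γ hγV, abs_of_pos (hpos γ hγV)]
      linarith
    have hxU : x ∈ ⋃ α ∈ A, R α := Set.mem_biUnion hβ hxR
    refine hgen x hxU ?_
    -- The regions are open and disjoint, so a connected set meeting `R β` stays in it.
    have hsub : connectedComponentIn (⋃ α ∈ A, R α) x ⊆ R β := by
      refine isPreconnected_connectedComponentIn.subset_left_of_subset_union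
        (isOpen_tropRegion hβ0) (v := ⋃ α ∈ V, R α)
        (isOpen_biUnion fun α hα => isOpen_tropRegion (hpos α hα).ne') ?_ ?_
        ⟨x, mem_connectedComponentIn hxU, hxR⟩
      · refine Set.disjoint_iUnion₂_right.2 fun α hα => disjoint_tropRegion hβ (hVA α hα) ?_
        exact fun hβα => h.notMem (hβα ▸ hα)
      · refine (connectedComponentIn_subset _ _).trans (Set.iUnion₂_subset fun α hα => ?_)
        by_cases hαβ : α = β
        · rw [hαβ]
          exact Set.subset_union_left
        · exact (Set.subset_biUnion_of_mem (u := R)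
            (Finset.mem_coe.2 (Finset.mem_erase.2 ⟨hαβ, hα⟩))).trans Set.subset_union_right
    refine Bornology.IsBounded.subset ?_ hsub
    refine h.isBounded (fun α => Real.log |f β| - Real.log |f α|) fun y hy α hα => ?_
    have := hy α (hVA α hα) (Finset.ne_of_mem_erase hα)
    rw [tropMonomial_tropLog (hpos α hα).ne', tropMonomial_tropLog hβ0, WithBot.coe_lt_coe] at this
    linarith
  · intro hle x hx hb
    obtain ⟨α, hα, hxα⟩ := Set.mem_iUnion₂.1 hx
    have hαV : α ∈ V := by
      refine Finset.mem_erase.2 ⟨?_, hα⟩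
      rintro rfl
      by_cases hα0 : f α = 0
      · obtain ⟨γ, hγ, hne⟩ := h.exists_mem_ne α
        have h1 := hxα γ (hVA γ hγ) hne
        simp only [hα0, tropMonomial_tropLog_zero] at h1
        exact not_lt_bot h1
      · have hαneg : 0 < -f α := by
          have := lt_of_le_of_ne hneg hα0
          linarith
        have hlog : Real.log |f α| ≤ ∑ γ ∈ V, w γ * Real.log (f γ) := by
          rw [abs_of_nonpos hneg]
          exact (Real.log_le_iff_le_exp hαneg).2 hle
        -- Averaging the strict inequalities with weights `w` cancels `x` and contradicts `hlog`.
        have hsum : ∑ γ ∈ V, w γ * (Real.log (f γ) + inner ℝ x γ) <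
            ∑ γ ∈ V, w γ * (Real.log |f α| + inner ℝ x α) := by
          obtain ⟨δ, hδ, -⟩ := h.exists_mem_ne α
          refine Finset.sum_lt_sum_of_nonempty ⟨δ, hδ⟩ fun γ hγ => ?_
          refine mul_lt_mul_of_pos_left ?_ (h.pos γ hγ)
          have h1 := hxα γ (hVA γ hγ) (Finset.ne_of_mem_erase hγ)
          rw [tropMonomial_tropLog (hpos γ hγ).ne', tropMonomial_tropLog hα0,
            WithBot.coe_lt_coe, abs_of_pos (hpos γ hγ)] at h1
          exact h1
        rw [← Finset.sum_mul, h.sum_eq_one, one_mul] at hsum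
        simp only [mul_add, Finset.sum_add_distrib] at hsum
        rw [← h.inner_eq] at hsum
        linarith
    obtain ⟨d, hd, hdβ⟩ := h.exists_exposing hαV
    have hβα : β ≠ α := fun hβα => h.notMem (hβα ▸ hαV)
    refine not_isBounded_tropRegion (hpos α hαV).ne' hβ hβα (d := d) (fun γ hγ hne => ?_) hxα
      (hb.subset ?_)
    · by_cases hγβ : γ = β
      · rwa [hγβ]
      · exact hd γ (Finset.mem_erase.2 ⟨hγβ, hγ⟩) hne
    · exact (convex_tropRegion (hpos α hαV).ne').isPreconnected.subset_connectedComponentIn hxα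
        (Set.subset_biUnion_of_mem (u := R) hα)

end DSONC

end

theorem mainTheorem11 (n : ℕ) (A : Finset (DSONC.Pt n)) (β : DSONC.Pt n) (f : DSONC.ExpSum n)
    (hf : DSONC.IsCircuitFunction A f)
    (hcard : A.card = n + 2)
    (hβ : β ∈ A)
    (hpos : ∀ α ∈ A, α ≠ β → 0 < f α)
    (hneg : f β ≤ 0) :
    f ∈ DSONC.dsoncCone A ↔
      DSONC.HasGenusZero (DSONC.tropHypersurface A fun α => DSONC.tropLog (f α)) := by
  classical
  have hA : DSONC.IsSimplicialCircuit A := by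
    refine hf.circuit.resolve_right ?_
    rintro ⟨α, rfl⟩
    rw [Finset.card_singleton] at hcard
    omega
  -- Vertex coefficients are positive, while `f β ≤ 0`.
  have hβv : β ∉ DSONC.vertices (A : Set (DSONC.Pt n)) := fun h =>
    (hf.vertex_pos β h).not_ge hneg
  obtain ⟨w, hw⟩ := hA.exists_isInteriorWeight hcard hβ hβv
  have hpos' : ∀ α ∈ A.erase β, 0 < f α := fun α hα =>
    hpos α (Finset.mem_of_mem_erase hα) (Finset.ne_of_mem_erase hα)
  rw [DSONC.mem_dsoncCone_iff hf hA hβ hβv hw hpos' hneg,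
    DSONC.hasGenusZero_iff hβ hw hpos' hneg]
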